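/- **Model.** In the $\mu$-CONGEST model, $n$ nodes with identifiers $1,\dots,n$ work in synchronous rounds. A word consists of $b$ bits, where $2^b\ge n$ (so a word can hold an identifier; usually $b=\Theta(\log n)$). Initially each node knows only its set of neighbours in the input graph $G$. In each round each node may send one message of one word to each of its neighbours in the communication network, which is $G$ itself. Between rounds a node retains only a memory of $\mu$ words, which also has to hold whatever the node keeps of its input. Outputs are emitted and take up no memory; local computation is unrestricted. In the all-to-all version the communication network is the complete graph, while the input is still an arbitrary graph $G$. A $k$-clique listing algorithm with round complexity $R$ is an algorithm, possibly randomized, such that for every graph $G$ on the $n$ nodes, with probability at least $1-1/n$, the union of the outputs of all nodes within the first $R$ rounds is exactly the set of all $k$-cliques of $G$. **Theorem.** Let $k\ge 3$ be a constant. There are $c>0$ and $n_0$, depending only on $k$, such that the following holds for all $n\ge n_0$, all integers $\ell,\mu$ with $1\le\ell\le n$ and $\ell\le\mu\le n^{2-2/k}$, and all $b$ with $2^b\ge n$. Consider any $k$-clique listing algorithm in $\mu$-CONGEST, or in its all-to-all version, in which, on every input graph, no node ever receives more than $\ell$ messages in a round. Its round complexity $R$ satisfies $$R\;\ge\; c\cdot\frac{n^{k-1}}{(b\mu)^{k/2-1}\cdot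 b\ell}\qquad\text{and hence}\qquad R\;\ge\; c\cdot\frac{n^{k-2}}{(b\mu)^{k/2-1}\cdot b}.$$ That is, the number of rounds is $\Omega\bigl(n^{k-1}/(\mu^{k/2-1}\ell)\bigr)=\Omega\bigl(n^{k-2}/\mu^{k/2-1}\bigr)$ when the memory ($b\mu$) and the amount of information received per round ($b\ell$) are measured in bits; in units of words of $b=\Theta(\log n)$ bits it is so up to a factor $\log^{k/2}n$. -/

import Mathlib

open MeasureTheory

namespace MuCongest

/-- A word (also: a message) consists of `b` bits. -/
abbrev Word (b : ℕ) : Type := Fin b → Bool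

/-- A local memory of `μ` words. -/
abbrev Memory (μ b : ℕ) : Type := Fin μ → Word b

/-- What a node receives in one round: from every node either nothing or a single message. -/
abbrev Inbox (n b : ℕ) : Type := Fin n → Option (Word b)

/-- A deterministic algorithm on the node set `Fin n` in which every node has a memory of `μ` words
of `b` bits. The behaviour of a node may depend arbitrarily on its identifier and on the round
number, and local computation is unrestricted, but between two rounds a node keeps nothing
but the content of its memory, which also has to hold whatever it wants to remember of its input.
Outputs (sets of nodes) are emitted and take up no memory. -/
structure Algorithm (n μ b : ℕ) where
  /-- the initial memory of a node, computed from its input: the set of its neighbours -/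
  init : Fin n → Set (Fin n) → Memory μ b
  /-- `send r u m v` is the message that `u`, with memory `m`, addresses to `v` in round `r` -/
  send : ℕ → Fin n → Memory μ b → Fin n → Option (Word b)
  /-- the memory of a node after round `r`, given its memory before it and what it received -/
  step : ℕ → Fin n → Memory μ b → Inbox n b → Memory μ b
  /-- what a node outputs before the first round -/
  emitStart : Fin n → Memory μ b → Set (Finset (Fin n))
  /-- what a node outputs in round `r`, given its memory before the round and what it received -/
  emit : ℕ → Fin n → Memory μ b → Inbox n b → Set (Finset (Fin n))

/-- The two communication models: in `congest` the input graph is the communication network;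
in `allToAll` every two nodes can communicate, whatever the input graph is. -/
inductive CommModel where
  | congest
  | allToAll

/-- The communication network when the input graph is `G`. -/
def CommModel.network {V : Type*} : CommModel → SimpleGraph V → SimpleGraph V
  | .congest, G => G
  | .allToAll, _ => ⊤

namespace Algorithm

variable {n μ b : ℕ}

open Classical in
/-- The messages that `v` receives in round `r` over the network `C` if the memory contents before
the round are `mem`. -/
noncomputable def deliver (A : Algorithm n μ b) (C : SimpleGraph (Fin n)) (r : ℕ)
    (mem : Fin n → Memory μ b) (v : Fin n) : Inbox n b :=
  fun u => if C.Adj u v then A.send r u (mem u) v else none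

/-- The memory content of every node after `r` rounds, on input graph `G`. -/
noncomputable def memory (A : Algorithm n μ b) (M : CommModel) (G : SimpleGraph (Fin n)) :
    ℕ → Fin n → Memory μ b
  | 0 => fun v => A.init v (G.neighborSet v)
  | r + 1 => fun v =>
      A.step r v (A.memory M G r v) (A.deliver (M.network G) r (A.memory M G r) v)

/-- The messages received by node `v` in round `r` (rounds are numbered from `0`). -/
noncomputable def inbox (A : Algorithm n μ b) (M : CommModel) (G : SimpleGraph (Fin n))
    (r : ℕ) (v : Fin n) : Inbox n b :=
  A.deliver (M.network G) r (A.memory M G r) v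

/-- No node ever receives more than `ℓ` messages in a round, on any input graph. -/
def ReceivesAtMost (A : Algorithm n μ b) (M : CommModel) (ℓ : ℕ) : Prop :=
  ∀ (G : SimpleGraph (Fin n)) (r : ℕ) (v : Fin n),
    (Finset.univ.filter fun u => (A.inbox M G r v u).isSome = true).card ≤ ℓ

/-- The set of everything that node `v` outputs within the first `R` rounds. -/
def output (A : Algorithm n μ b) (M : CommModel) (G : SimpleGraph (Fin n)) (R : ℕ)
    (v : Fin n) : Set (Finset (Fin n)) :=
  A.emitStart v (A.memory M G 0 v) ∪
    ⋃ r ∈ Finset.range R, A.emit r v (A.memory M G r v) (A.inbox M G r v)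

/-- On input `G`, the union of the outputs of all nodes within the first `R` rounds is exactly the
set of the `k`-cliques of `G`. -/
def ListsCliques (A : Algorithm n μ b) (M : CommModel) (k R : ℕ) (G : SimpleGraph (Fin n)) : Prop :=
  (⋃ v, A.output M G R v) = G.cliqueSet k

end Algorithm

/-- A randomized algorithm, given as a deterministic algorithm `A ω` for every outcome `ω` of the
coins, lists on every input graph all `k`-cliques within `R` rounds with high probability, that is
with probability at least `1 - 1 / n`. -/
def ListsCliquesWHP {n μ b : ℕ} {Ω : Type*} [MeasurableSpace Ω] (P : Measure Ω)
    (A : Ω → Algorithm n μ b) (M : CommModel) (k R : ℕ) : Prop :=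
  ∀ G : SimpleGraph (Fin n),
    NullMeasurableSet {ω | (A ω).ListsCliques M k R G} P ∧
      1 - 1 / (n : ℝ) ≤ P.real {ω | (A ω).ListsCliques M k R G}

end MuCongest

/-!
The proof is a counting argument over all graphs on `Fin n`, that is over a uniformly random input.
By averaging, some outcome of the coins gives a deterministic algorithm that is correct on all but a
fraction `1 / n` of the graphs (`ListsCliquesWHP.exists_deterministic`).

Cut the execution into windows of `μ / ℓ` rounds. What a node outputs in a window is a function of
its memory at the beginning and of the at most `μ` messages that it receives, so that it takes
at most `2 ^ (4 * b * μ)` values (`Algorithm.ncard_range_windowOutput_le`). A value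
whose members cover `s` pairs of vertices can be correct only for a fraction `2 ^ (-s)` of the
graphs, since all these pairs have to be edges (`card_supergraphs`). By a union bound over
the values (`card_correct_large_le`) and over the nodes and windows, on most graphs every node
outputs in every window cliques that cover fewer than `s = O(b * μ)` pairs, and by Kruskal–Katona
there are only `O(s ^ (k / 2))` of them (`card_le_of_pairGraph`). As a random graph has
`Ω(n ^ k)` cliques in expectation (`card_mul_choose_le_sum_cliques`), the number of windows is
`Ω(n ^ (k - 1) / (b * μ) ^ (k / 2))` (`choose_le_of_listing`), and multiplying by `μ / ℓ` gives the
bound.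

An execution of less than one window needs a separate treatment
(`Algorithm.pow_le_of_short`), because there the count of windows is rounded up to one. Then the
whole output of a node depends on its neighbourhood, `n` bits, and on `O(b * ℓ * R)` bits of
messages. The `n` bits alone are too few, as `n ^ (k / 2)` is `o(n ^ (k - 1))` for `k ≥ 3`. So
`n ^ (k - 1) = O((b * ℓ * R) ^ (k / 2))`, and this suffices since `b * ℓ * R ≤ b * μ`.
-/

namespace MuCongest

/-! ### Counting graphs and the cliques they contain -/

section Counting

open scoped Classical FinsetFamily
open Finset

/-- The graph covered by a family of vertex sets: two distinct vertices are adjacent if they lie in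
a common member, so that it is the least graph in which every member of the family is a clique. -/
def pairGraph {V : Type*} (𝒦 : Set (Finset V)) : SimpleGraph V where
  Adj x y := x ≠ y ∧ ∃ K ∈ 𝒦, x ∈ K ∧ y ∈ K
  symm := ⟨fun _ _ ⟨h, K, hK, hx, hy⟩ => ⟨h.symm, K, hK, hy, hx⟩⟩
  loopless := ⟨fun _ h => h.1 rfl⟩

theorem pairGraph_le_iff {V : Type*} {𝒦 : Set (Finset V)} {G : SimpleGraph V} :
    pairGraph 𝒦 ≤ G ↔ ∀ K ∈ 𝒦, G.IsClique (K : Set V) := by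
  constructor
  · intro h K hK x hx y hy hxy
    exact h ⟨hxy, K, hK, hx, hy⟩
  · rintro h x y ⟨hxy, K, hK, hx, hy⟩
    exact h K hK hx hy hxy

/-- A graph is determined by its union and its intersection with `H`. -/
def supSubgraphEquiv {V : Type*} (H : SimpleGraph V) :
    {G : SimpleGraph V // H ≤ G} × {S : SimpleGraph V // S ≤ H} ≃ SimpleGraph V where
  toFun p := (p.1.1 \ H) ⊔ p.2.1
  invFun G := (⟨G ⊔ H, le_sup_right⟩, ⟨G ⊓ H, inf_le_right⟩)
  left_inv := by
    rintro ⟨⟨G, hG⟩, ⟨S, hS⟩⟩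
    simp only [Prod.mk.injEq, Subtype.mk.injEq]
    refine ⟨?_, ?_⟩
    · rw [sup_assoc, sup_eq_right.2 hS, sdiff_sup_cancel hG]
    · rw [inf_sup_right, inf_eq_left.2 hS, inf_comm, inf_sdiff_self_right, bot_sup_eq]
  right_inv := by
    intro G
    simp only [sup_sdiff_right_self]
    exact sup_comm _ _ |>.trans (sup_inf_sdiff G H)

theorem card_subgraphs {V : Type*} [Fintype V] [DecidableEq V] (H : SimpleGraph V) :
    Fintype.card {S : SimpleGraph V // S ≤ H} = 2 ^ H.edgeSet.ncard := by
  rw [Set.ncard_eq_toFinset_card', ← card_powerset, Fintype.card_subtype]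
  refine card_bij (fun S _ => S.edgeSet.toFinset) ?_ ?_ ?_
  · intro S hS
    simpa using hS
  · intro S _ S' _ h
    simpa using h
  · intro D hD
    have hD' : (D : Set (Sym2 V)) ⊆ H.edgeSet := by simpa using hD
    refine ⟨SimpleGraph.fromEdgeSet D, ?_, ?_⟩
    · rw [mem_filter]
      refine ⟨mem_univ _, ?_⟩
      rw [← SimpleGraph.edgeSet_subset_edgeSet, SimpleGraph.edgeSet_fromEdgeSet]
      exact Set.sdiff_subset.trans hD'
    · ext e
      simp only [Set.mem_toFinset, SimpleGraph.edgeSet_fromEdgeSet, Set.mem_sdiff, mem_coe]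
      exact ⟨fun h => h.1, fun h => ⟨h, fun hd => H.not_isDiag_of_mem_edgeSet (hD' h) hd⟩⟩

/-- A uniformly random graph contains `H` with probability `2 ^ (-e)`, where `e` is the number of
edges of `H`. -/
theorem card_supergraphs {V : Type*} [Fintype V] [DecidableEq V] (H : SimpleGraph V) :
    #{G : SimpleGraph V | H ≤ G} * 2 ^ H.edgeSet.ncard = Fintype.card (SimpleGraph V) := by
  rw [← Fintype.card_congr (supSubgraphEquiv H), Fintype.card_prod, card_subgraphs,
    Fintype.card_subtype]

variable {n k : ℕ}

/-- By the Kruskal–Katona theorem, `k`-sets covering fewer than `x.choose 2` pairs are at most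
`x ^ k` in number. -/
theorem card_le_of_pairGraph (hk : 2 ≤ k) {x : ℕ} (hkx : k ≤ x) (𝒜 : Finset (Finset (Fin n)))
    (h𝒜 : ∀ K ∈ 𝒜, #K = k)
    (hx : (pairGraph (𝒜 : Set (Finset (Fin n)))).edgeSet.ncard < x.choose 2) :
    #𝒜 ≤ x ^ k := by
  refine le_trans ?_ (Nat.choose_le_pow x k)
  have hsized : (𝒜 : Set (Finset (Fin n))).Sized k := fun K hK => h𝒜 K hK
  rcases le_or_gt x n with hxn | hxn
  · by_contra! hlt
    have hkk := kruskal_katona_lovasz_form (i := k - 2) (by omega) hkx hxn hsized hlt.le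
    rw [show k - (k - 2) = 2 by omega] at hkk
    have hsub : ∂^[k - 2] 𝒜 ⊆
        (pairGraph (𝒜 : Set (Finset (Fin n)))).edgeSet.toFinset.image Sym2.toFinset := by
      intro t ht
      obtain ⟨K, hK, htK, hcard⟩ := mem_shadow_iterate_iff_exists_mem_card_add.1 ht
      have ht2 : #t = 2 := by have := h𝒜 K hK; omega
      obtain ⟨a, c, hac, rfl⟩ := card_eq_two.1 ht2
      rw [mem_image]
      refine ⟨s(a, c), ?_, by ext; simp⟩
      simp only [Set.mem_toFinset, SimpleGraph.mem_edgeSet]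
      exact ⟨hac, K, hK, htK (by simp), htK (by simp)⟩
    have := (card_le_card hsub).trans card_image_le
    rw [← Set.ncard_eq_toFinset_card'] at this
    omega
  · calc #𝒜 ≤ n.choose k := by simpa using hsized.card_le
      _ ≤ x.choose k := Nat.choose_le_choose k hxn.le

theorem ncard_edgeSet_pairGraph_singleton_le (K : Finset (Fin n)) :
    (pairGraph {K}).edgeSet.ncard ≤ #K ^ 2 := by
  have hsub : (pairGraph {K}).edgeSet ⊆ ((K ×ˢ K).image fun p => s(p.1, p.2) :
      Finset (Sym2 (Fin n))) := by
    intro e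
    induction e with
    | _ a c =>
      rintro ⟨-, L, rfl, ha, hc⟩
      exact mem_coe.2 (mem_image.2 ⟨(a, c), mem_product.2 ⟨ha, hc⟩, rfl⟩)
  calc _ ≤ _ := Set.ncard_le_ncard hsub
    _ ≤ #(K ×ˢ K) := by rw [Set.ncard_coe_finset]; exact card_image_le
    _ = #K ^ 2 := by rw [card_product, sq]

/-- A uniformly random graph has in expectation at least `n.choose k / 2 ^ (k ^ 2)` cliques of size
`k`. -/
theorem card_mul_choose_le_sum_cliques (n k : ℕ) :
    Fintype.card (SimpleGraph (Fin n)) * n.choose k ≤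
      2 ^ k ^ 2 * ∑ G : SimpleGraph (Fin n), (G.cliqueSet k).ncard := by
  have hcl : ∀ G : SimpleGraph (Fin n),
      (G.cliqueSet k).ncard =
        #((powersetCard k univ).filter fun K : Finset (Fin n) => G.IsClique (K : Set (Fin n))) := by
    intro G
    rw [← Set.ncard_coe_finset]
    congr 1
    ext K
    simp [SimpleGraph.isNClique_iff, and_comm]
  have hdouble := sum_card_bipartiteAbove_eq_sum_card_bipartiteBelow (s := univ)
    (t := powersetCard k univ)
    (fun (G : SimpleGraph (Fin n)) (K : Finset (Fin n)) => G.IsClique (K : Set (Fin n)))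
  rw [sum_congr rfl fun G _ => hcl G]
  refine le_of_le_of_eq ?_ (congrArg (2 ^ k ^ 2 * ·) hdouble).symm
  rw [mul_sum]
  calc Fintype.card (SimpleGraph (Fin n)) * n.choose k
      = ∑ K ∈ powersetCard k (univ : Finset (Fin n)), Fintype.card (SimpleGraph (Fin n)) := by
        rw [sum_const, card_powersetCard, card_univ, Fintype.card_fin, smul_eq_mul, mul_comm]
    _ ≤ _ := by
        refine sum_le_sum fun K hK => ?_
        rw [← card_supergraphs (pairGraph {K}), mul_comm]
        refine Nat.mul_le_mul (Nat.pow_le_pow_right two_pos ?_) (card_le_card ?_)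
        · rw [← (mem_powersetCard.1 hK).2]
          exact ncard_edgeSet_pairGraph_singleton_le K
        · intro G hG
          simpa [bipartiteBelow, pairGraph_le_iff] using hG

/-- If a map `O` from graphs to families takes at most `Q` values, then few graphs `G` have the
property that `O G` consists of cliques of `G` which cover at least `s` pairs: each value of `O` is
compatible with a fraction `2 ^ (-s)` of all graphs at most. -/
theorem card_correct_large_le (O : SimpleGraph (Fin n) → Set (Finset (Fin n))) {Q : ℕ}
    (hQ : (Set.range O).ncard ≤ Q) (s : ℕ) :
    #{G | pairGraph (O G) ≤ G ∧ s ≤ (pairGraph (O G)).edgeSet.ncard} * 2 ^ s ≤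
      Q * Fintype.card (SimpleGraph (Fin n)) := by
  set 𝒱 : Finset (Set (Finset (Fin n))) :=
    (Set.range O).toFinset.filter fun 𝒦 => s ≤ (pairGraph 𝒦).edgeSet.ncard with h𝒱
  have hsub : ({G | pairGraph (O G) ≤ G ∧ s ≤ (pairGraph (O G)).edgeSet.ncard} : Finset _) ⊆
      𝒱.biUnion fun 𝒦 => {G | pairGraph 𝒦 ≤ G} := by
    intro G hG
    simp only [mem_filter, mem_univ, true_and] at hG
    simp only [mem_biUnion, h𝒱, mem_filter, Set.mem_toFinset, Set.mem_range, mem_univ, true_and]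
    exact ⟨O G, ⟨⟨G, rfl⟩, hG.2⟩, hG.1⟩
  calc _ ≤ (∑ 𝒦 ∈ 𝒱, #{G : SimpleGraph (Fin n) | pairGraph 𝒦 ≤ G}) * 2 ^ s :=
        Nat.mul_le_mul_right _ ((card_le_card hsub).trans card_biUnion_le)
    _ = ∑ 𝒦 ∈ 𝒱, #{G : SimpleGraph (Fin n) | pairGraph 𝒦 ≤ G} * 2 ^ s := sum_mul _ _ _
    _ ≤ ∑ 𝒦 ∈ 𝒱, Fintype.card (SimpleGraph (Fin n)) := by
        refine sum_le_sum fun 𝒦 h => ?_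
        rw [← card_supergraphs (pairGraph 𝒦)]
        exact Nat.mul_le_mul_left _ (Nat.pow_le_pow_right two_pos (mem_filter.1 h).2)
    _ ≤ _ := by
        rw [sum_const, smul_eq_mul]
        refine Nat.mul_le_mul_right _ (le_trans ?_ hQ)
        rw [Set.ncard_eq_toFinset_card']
        exact card_filter_le _ _

/-- The combinatorial core: if for most graphs the `k`-cliques are exactly what the maps `O i` give
together, and each of these maps takes few values, then there must be many of them. -/
theorem choose_le_of_listing {ι : Type*} [Fintype ι]
    (O : ι → SimpleGraph (Fin n) → Set (Finset (Fin n))) {Q s x : ℕ}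
    (hQ : ∀ i, (Set.range (O i)).ncard ≤ Q) (hs : Fintype.card ι * n * Q ≤ 2 ^ s)
    (good : SimpleGraph (Fin n) → Prop) (hgood : ∀ G, good G → ⋃ i, O i G = G.cliqueSet k)
    (hmost : #{G | ¬ good G} * n ≤ Fintype.card (SimpleGraph (Fin n)))
    (hn : 4 * 2 ^ k ^ 2 ≤ n) (hx : s ≤ x.choose 2) (hk : 2 ≤ k) (hkx : k ≤ x) :
    n.choose k ≤ 2 * 2 ^ k ^ 2 * Fintype.card ι * x ^ k := by
  set N := Fintype.card (SimpleGraph (Fin n)) with hN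
  have hN0 : 0 < N := Fintype.card_pos
  set bad : ι → Finset (SimpleGraph (Fin n)) := fun i =>
    {G | pairGraph (O i G) ≤ G ∧ s ≤ (pairGraph (O i G)).edgeSet.ncard} with hbad
  set B := ({G | ¬ good G} : Finset (SimpleGraph (Fin n))) ∪ univ.biUnion bad with hB
  have hBcard : #B * n ≤ 2 * N := by
    have h1 : #(univ.biUnion bad) * n ≤ N := by
      refine Nat.le_of_mul_le_mul_right ?_ (pow_pos two_pos s)
      calc #(univ.biUnion bad) * n * 2 ^ s ≤ (∑ i, #(bad i)) * n * 2 ^ s := by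
            gcongr
            exact card_biUnion_le
        _ = (∑ i, #(bad i) * 2 ^ s) * n := by rw [← sum_mul]; ring
        _ ≤ (∑ _i : ι, Q * N) * n := by
            exact Nat.mul_le_mul_right _
              (sum_le_sum fun i _ => card_correct_large_le (O i) (hQ i) s)
        _ = Fintype.card ι * n * Q * N := by rw [sum_const, smul_eq_mul, card_univ]; ring
        _ ≤ 2 ^ s * N := by gcongr
        _ = N * 2 ^ s := mul_comm _ _
    have h2 : #B ≤ #({G | ¬ good G} : Finset (SimpleGraph (Fin n))) + #(univ.biUnion bad) :=
      card_union_le _ _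
    calc #B * n ≤ (#({G | ¬ good G} : Finset (SimpleGraph (Fin n))) + #(univ.biUnion bad)) * n := by
          gcongr
      _ ≤ 2 * N := by rw [add_mul]; omega
  have hcl : ∀ G, G ∉ B → (G.cliqueSet k).ncard ≤ Fintype.card ι * x ^ k := by
    intro G hG
    simp only [hB, hbad, mem_union, mem_filter, mem_univ, true_and, mem_biUnion, not_or, not_not,
      not_exists, not_and, not_le] at hG
    obtain ⟨hg, hsmall⟩ := hG
    have hO : ∀ i, O i G ⊆ G.cliqueSet k := fun i => by
      rw [← hgood G hg]
      exact Set.subset_iUnion (fun i => O i G) i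
    rw [← hgood G hg]
    have hU : (⋃ i, O i G) = ((univ.biUnion fun i => (O i G).toFinset : Finset _) :
        Set (Finset (Fin n))) := by
      ext K; simp
    rw [hU, Set.ncard_coe_finset]
    calc _ ≤ ∑ i, #(O i G).toFinset := card_biUnion_le
      _ ≤ ∑ _i : ι, x ^ k := by
          refine sum_le_sum fun i _ => card_le_of_pairGraph hk hkx _ ?_ ?_
          · intro K hK
            exact (hO i (Set.mem_toFinset.1 hK)).2
          · rw [Set.coe_toFinset]
            refine (hsmall i (pairGraph_le_iff.2 fun K hK => (hO i hK).1)).trans_le hx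
      _ = _ := by rw [sum_const, smul_eq_mul, card_univ]
  have hclB : ∀ G : SimpleGraph (Fin n), (G.cliqueSet k).ncard ≤ n.choose k := by
    intro G
    rw [← SimpleGraph.coe_cliqueFinset, Set.ncard_coe_finset]
    simpa using G.card_cliqueFinset_le (n := k)
  have hsum : ∑ G : SimpleGraph (Fin n), (G.cliqueSet k).ncard ≤
      N * (Fintype.card ι * x ^ k) + #B * n.choose k := by
    calc ∑ G : SimpleGraph (Fin n), (G.cliqueSet k).ncard
        ≤ ∑ G : SimpleGraph (Fin n),
            (Fintype.card ι * x ^ k + if G ∈ B then n.choose k else 0) := by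
          refine sum_le_sum fun G _ => ?_
          split_ifs with h
          · exact (hclB G).trans (Nat.le_add_left _ _)
          · exact (hcl G h).trans (Nat.le_add_right _ _)
      _ = _ := by
          rw [sum_add_distrib, sum_const, smul_eq_mul, card_univ, sum_ite_mem, univ_inter,
            sum_const, smul_eq_mul]
  have hmain := (card_mul_choose_le_sum_cliques n k).trans (Nat.mul_le_mul_left _ hsum)
  rw [← hN] at hmain
  set C := n.choose k
  set W := 2 ^ k ^ 2
  set Y := Fintype.card ι * x ^ k with hY
  have hW : 0 < W := pow_pos two_pos _
  have h1 : N * (n * C) ≤ N * (W * (n * Y) + 2 * W * C) := by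
    calc N * (n * C) = (N * C) * n := by ring
      _ ≤ W * (N * Y + #B * C) * n := by gcongr
      _ = W * (N * Y * n + (#B * n) * C) := by ring
      _ ≤ W * (N * Y * n + 2 * N * C) := by gcongr
      _ = _ := by ring
  have h2 := Nat.le_of_mul_le_mul_left h1 hN0
  have hn0 : 0 < n := lt_of_lt_of_le (by positivity) hn
  refine Nat.le_of_mul_le_mul_left ?_ hn0
  have h3 : 4 * W * C ≤ n * C := Nat.mul_le_mul_right _ hn
  calc n * C ≤ 2 * (W * (n * Y)) := by nlinarith
    _ = n * (2 * W * Fintype.card ι * x ^ k) := by rw [hY]; ring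

end Counting

/-! ### The information that a node has in a window of rounds -/

section Windows

open scoped Classical

/-- The inboxes that hold at most `ℓ` messages. -/
abbrev BoundedInbox (n b ℓ : ℕ) : Type :=
  {I : Inbox n b // (Finset.univ.filter fun u => (I u).isSome = true).card ≤ ℓ}

theorem card_memory (μ b : ℕ) : Fintype.card (Memory μ b) = 2 ^ (b * μ) := by
  simp [Memory, Word, ← pow_mul]

/-- As a sender is described by `b` bits, so is an inbox with at most `ℓ` messages by `O(b * ℓ)`
bits. -/
theorem card_boundedInbox_le {n b ℓ : ℕ} (hb : 1 ≤ b) (hn : n ≤ 2 ^ b) :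
    Fintype.card (BoundedInbox n b ℓ) ≤ 2 ^ (3 * b * ℓ) := by
  -- the list of the messages with their senders determines the inbox
  let decode : (Fin ℓ → Option (Fin n × Word b)) → Inbox n b := fun f u =>
    if h : ∃ w i, f i = some (u, w) then some h.choose else none
  have hsurj : ∀ I : BoundedInbox n b ℓ, ∃ f, decode f = I.1 := by
    rintro ⟨I, hI⟩
    set S := Finset.univ.filter fun u => (I u).isSome = true with hS
    have hS' : ∀ {u w}, I u = some w → u ∈ S := fun {u w} h => by simp [hS, h]
    let e := S.equivFin
    refine ⟨fun i => if h : (i : ℕ) < S.card then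
      (I (e.symm ⟨i, h⟩)).map fun w => ((e.symm ⟨i, h⟩ : Fin n), w) else none, ?_⟩
    have key : ∀ u w, (∃ i : Fin ℓ, (if h : (i : ℕ) < S.card then
        (I (e.symm ⟨i, h⟩)).map fun w => ((e.symm ⟨i, h⟩ : Fin n), w) else none) = some (u, w)) ↔
        I u = some w := by
      intro u w
      constructor
      · rintro ⟨i, hi⟩
        split_ifs at hi with h
        obtain ⟨w', hw', heq⟩ := Option.map_eq_some_iff.1 hi
        simp only [Prod.mk.injEq] at heq
        rw [← heq.1, ← heq.2, hw']
      · intro h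
        have hlt : ((e ⟨u, hS' h⟩ : Fin S.card) : ℕ) < S.card := (e ⟨u, hS' h⟩).2
        refine ⟨⟨e ⟨u, hS' h⟩, hlt.trans_le hI⟩, ?_⟩
        simp [h]
    funext u
    simp only [decode, key]
    by_cases h : ∃ w, I u = some w
    · rw [dif_pos h]
      exact h.choose_spec.symm
    · rw [dif_neg h]
      exact (Option.eq_none_iff_forall_ne_some.2 fun w hw => h ⟨w, hw⟩).symm
  choose encode hencode using hsurj
  have hinj : Function.Injective encode := fun I J h => by
    apply Subtype.ext
    rw [← hencode I, ← hencode J, h]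
  calc Fintype.card (BoundedInbox n b ℓ)
      ≤ Fintype.card (Fin ℓ → Option (Fin n × Word b)) := Fintype.card_le_of_injective _ hinj
    _ = (n * 2 ^ b + 1) ^ ℓ := by simp [Word]
    _ ≤ (2 ^ (3 * b)) ^ ℓ := by
        gcongr
        have h1 : 1 ≤ 2 ^ b := Nat.one_le_two_pow
        have h2 : 2 ^ 1 ≤ 2 ^ b := Nat.pow_le_pow_right two_pos hb
        calc n * 2 ^ b + 1 ≤ 2 ^ b * 2 ^ b + 2 ^ b * 2 ^ b := by gcongr; nlinarith
          _ = 2 * (2 ^ b * 2 ^ b) := by ring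
          _ ≤ 2 ^ b * (2 ^ b * 2 ^ b) := by gcongr; simpa using h2
          _ = 2 ^ (3 * b) := by rw [← pow_add, ← pow_add]; congr 1; ring
    _ = 2 ^ (3 * b * ℓ) := by rw [← pow_mul]

namespace Algorithm

variable {n μ b : ℕ}

/-- The memory of `v` at `i` rounds after round `r₀`, computed from its memory `m` before
round `r₀` and the inboxes `I 0, I 1, …` that it finds from there on. -/
def replay (A : Algorithm n μ b) (v : Fin n) (r₀ : ℕ) (m : Memory μ b) (I : ℕ → Inbox n b) :
    ℕ → Memory μ b
  | 0 => m
  | i + 1 => A.step (r₀ + i) v (A.replay v r₀ m I i) (I i)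

theorem replay_eq_memory (A : Algorithm n μ b) (M : CommModel) (G : SimpleGraph (Fin n))
    (v : Fin n) (r₀ T : ℕ) (I : ℕ → Inbox n b) (hI : ∀ i < T, I i = A.inbox M G (r₀ + i) v) :
    ∀ i ≤ T, A.replay v r₀ (A.memory M G r₀ v) I i = A.memory M G (r₀ + i) v := by
  intro i
  induction i with
  | zero => intro _; rfl
  | succ i ih =>
    intro hi
    simp only [replay, ih (by omega), hI i (by omega)]
    rfl

/-- What `v` outputs in the `T` rounds that start with round `r₀`; the output before round `0` is
counted with round `0`. -/
def windowOutput (A : Algorithm n μ b) (M : CommModel) (v : Fin n) (r₀ T : ℕ)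
    (G : SimpleGraph (Fin n)) : Set (Finset (Fin n)) :=
  {K | r₀ = 0 ∧ K ∈ A.emitStart v (A.memory M G r₀ v)} ∪
    ⋃ i ∈ Finset.range T, A.emit (r₀ + i) v (A.memory M G (r₀ + i) v) (A.inbox M G (r₀ + i) v)

theorem windowOutput_zero (A : Algorithm n μ b) (M : CommModel) (v : Fin n) (R : ℕ)
    (G : SimpleGraph (Fin n)) : A.windowOutput M v 0 R G = A.output M G R v := by
  simp [windowOutput, output]

/-- The first `R` rounds can be cut into windows of length `T`, the last one being cut off at
round `R`. -/
theorem iUnion_windowOutput (A : Algorithm n μ b) (M : CommModel) (v : Fin n) {R T : ℕ}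
    (hT : 0 < T) (G : SimpleGraph (Fin n)) :
    ⋃ j : Fin (R / T + 1), A.windowOutput M v (j * T) (min T (R - j * T)) G =
      A.output M G R v := by
  ext K
  simp only [windowOutput, output, Set.mem_iUnion, Set.mem_union, Set.mem_ofPred_eq,
    Finset.mem_range, exists_prop]
  constructor
  · rintro ⟨j, ⟨h0, hK⟩ | ⟨i, hi, hK⟩⟩
    · rw [h0] at hK
      exact Or.inl hK
    · refine Or.inr ⟨j * T + i, ?_, hK⟩
      have := lt_min_iff.1 hi
      omega
  · rintro (hK | ⟨r, hr, hK⟩)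
    · exact ⟨0, Or.inl ⟨by simp, by simpa using hK⟩⟩
    · have hdiv : r / T * T + r % T = r := by rw [mul_comm]; exact Nat.div_add_mod r T
      refine ⟨⟨r / T, Nat.lt_succ_of_le (Nat.div_le_div_right hr.le)⟩, Or.inr ⟨r % T, ?_, ?_⟩⟩
      · exact lt_min (Nat.mod_lt _ hT) (by simp only; omega)
      · simp only [hdiv]
        exact hK

/-- The output of a node in a window is a function of its memory before the window and of the
messages that it receives during the window. -/
theorem ncard_range_windowOutput_le (A : Algorithm n μ b) (M : CommModel) {ℓ : ℕ}
    (hA : A.ReceivesAtMost M ℓ) (hb : 1 ≤ b) (hn : n ≤ 2 ^ b) (v : Fin n) (r₀ T : ℕ)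
    {X : Type*} [Fintype X] (h : SimpleGraph (Fin n) → X) (g : X → Memory μ b)
    (hg : ∀ G, A.memory M G r₀ v = g (h G)) :
    (Set.range (A.windowOutput M v r₀ T)).ncard ≤ Fintype.card X * 2 ^ (3 * b * ℓ * T) := by
  let extend : (Fin T → BoundedInbox n b ℓ) → ℕ → Inbox n b := fun I i =>
    if hi : i < T then (I ⟨i, hi⟩).1 else fun _ => none
  let Φ : X × (Fin T → BoundedInbox n b ℓ) → Set (Finset (Fin n)) := fun p =>
    {K | r₀ = 0 ∧ K ∈ A.emitStart v (g p.1)} ∪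
      ⋃ i ∈ Finset.range T, A.emit (r₀ + i) v (A.replay v r₀ (g p.1) (extend p.2) i)
        (extend p.2 i)
  have hsub : Set.range (A.windowOutput M v r₀ T) ⊆ Φ '' Set.univ := by
    rintro _ ⟨G, rfl⟩
    let I : Fin T → BoundedInbox n b ℓ := fun i => ⟨A.inbox M G (r₀ + i) v, hA G (r₀ + i) v⟩
    have hI : ∀ i < T, extend I i = A.inbox M G (r₀ + i) v := fun i hi => by simp [extend, I, hi]
    refine ⟨(h G, I), Set.mem_univ _, ?_⟩
    simp only [Φ, windowOutput, ← hg]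
    congr 1
    refine Set.iUnion₂_congr fun i hi => ?_
    have hi' := Finset.mem_range.1 hi
    rw [A.replay_eq_memory M G v r₀ T _ hI i hi'.le, hI i hi']
  calc _ ≤ (Φ '' Set.univ).ncard := Set.ncard_le_ncard hsub (Set.toFinite _)
    _ ≤ (Set.univ : Set (X × (Fin T → BoundedInbox n b ℓ))).ncard :=
        Set.ncard_image_le (Set.toFinite _)
    _ = Fintype.card X * Fintype.card (BoundedInbox n b ℓ) ^ T := by
        rw [Set.ncard_univ, Nat.card_eq_fintype_card, Fintype.card_prod, Fintype.card_fun,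
          Fintype.card_fin]
    _ ≤ Fintype.card X * (2 ^ (3 * b * ℓ)) ^ T := by
        gcongr
        exact card_boundedInbox_le hb hn
    _ = _ := by rw [← pow_mul]

end Algorithm

/-- Averaging over the input graph: some outcome of the coins is good for all but a fraction `1 / n`
of all graphs. -/
theorem ListsCliquesWHP.exists_deterministic {n μ b k R : ℕ} {Ω : Type*} [MeasurableSpace Ω]
    {P : Measure Ω} [IsProbabilityMeasure P] {A : Ω → Algorithm n μ b} {M : CommModel}
    (hn : 0 < n) (h : ListsCliquesWHP P A M k R) :
    ∃ ω, (Finset.univ.filter fun G => ¬ (A ω).ListsCliques M k R G).card * n ≤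
      Fintype.card (SimpleGraph (Fin n)) := by
  set N := Fintype.card (SimpleGraph (Fin n)) with hN
  let S : SimpleGraph (Fin n) → Set Ω := fun G => {ω | (A ω).ListsCliques M k R G}
  have hint : ∀ G, Integrable ((S G).indicator fun _ => (1 : ℝ)) P := fun G =>
    (integrable_const 1).indicator₀ (h G).1
  obtain ⟨ω, hω⟩ := exists_integral_le (integrable_finsetSum Finset.univ fun G _ => hint G)
  refine ⟨ω, ?_⟩
  rw [integral_finsetSum _ fun G _ => hint G] at hω
  have hlow : (N : ℝ) * (1 - 1 / n) ≤
      ∑ G, ∫ ω, (S G).indicator (fun _ => (1 : ℝ)) ω ∂P := by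
    calc (N : ℝ) * (1 - 1 / n) = ∑ _G : SimpleGraph (Fin n), (1 - 1 / (n : ℝ)) := by
          rw [Finset.sum_const, Finset.card_univ, nsmul_eq_mul]
      _ ≤ _ := by
          refine Finset.sum_le_sum fun G _ => ?_
          rw [integral_indicator₀ (h G).1, setIntegral_const, smul_eq_mul, mul_one]
          exact (h G).2
  have hgood : (∑ G, (S G).indicator (fun _ => (1 : ℝ)) ω) =
      (Finset.univ.filter fun G => (A ω).ListsCliques M k R G).card := by
    rw [Finset.card_filter]
    push_cast
    refine Finset.sum_congr rfl fun G _ => ?_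
    simp [S, Set.indicator_apply]
  have hsplit := Finset.card_filter_add_card_filter_not (s := Finset.univ)
    fun G => (A ω).ListsCliques M k R G
  rw [Finset.card_univ, ← hN] at hsplit
  have hbad := hlow.trans hω
  rw [hgood] at hbad
  have hsplit' : ((Finset.univ.filter fun G => (A ω).ListsCliques M k R G).card : ℝ) +
      (Finset.univ.filter fun G => ¬ (A ω).ListsCliques M k R G).card = N := by
    exact_mod_cast hsplit
  have hn' : (0 : ℝ) < n := by exact_mod_cast hn
  have hfin : ((Finset.univ.filter fun G => ¬ (A ω).ListsCliques M k R G).card : ℝ) ≤ N / n := by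
    have : (N : ℝ) * (1 - 1 / n) = N - N / n := by ring
    linarith
  rw [le_div_iff₀ hn'] at hfin
  exact_mod_cast hfin

end Windows

/-! ### From counting to round complexity -/

section Bounds

open scoped Classical

/-- The constant of `pow_le_of_listing`. -/
def listingConst (k : ℕ) : ℕ := 2 ^ k * k.factorial * (2 * 2 ^ k ^ 2) * (k + 4) ^ k

theorem listingConst_pos (k : ℕ) : 0 < listingConst k := by
  unfold listingConst
  have := k.factorial_pos
  positivity

theorem pow_le_mul_choose {n k : ℕ} (h : 2 * k ≤ n) :
    n ^ k ≤ 2 ^ k * k.factorial * n.choose k := by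
  calc n ^ k ≤ (2 * (n + 1 - k)) ^ k := by gcongr; omega
    _ = 2 ^ k * (n + 1 - k) ^ k := mul_pow _ _ _
    _ ≤ 2 ^ k * n.descFactorial k := by gcongr; exact n.pow_sub_le_descFactorial k
    _ = _ := by rw [Nat.descFactorial_eq_factorial_mul_choose, mul_assoc]

/-- `choose_le_of_listing` with `x` of order `√s`: each of the maps `O i` contributes
`O(s ^ (k / 2))` cliques at most. -/
theorem pow_le_of_listing {n k : ℕ} {ι : Type*} [Fintype ι]
    (O : ι → SimpleGraph (Fin n) → Set (Finset (Fin n))) {Q s : ℕ}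
    (hQ : ∀ i, (Set.range (O i)).ncard ≤ Q) (hs : Fintype.card ι * n * Q ≤ 2 ^ s)
    (good : SimpleGraph (Fin n) → Prop) (hgood : ∀ G, good G → ⋃ i, O i G = G.cliqueSet k)
    (hmost : (Finset.univ.filter fun G => ¬ good G).card * n ≤
      Fintype.card (SimpleGraph (Fin n)))
    (hn : 4 * 2 ^ k ^ 2 ≤ n) (hnk : 2 * k ≤ n) (hk : 2 ≤ k) (hs1 : 1 ≤ s) :
    (n : ℝ) ^ k ≤ listingConst k * Fintype.card ι * (s : ℝ) ^ ((k : ℝ) / 2) := by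
  set q := Nat.sqrt s with hq
  set x := 2 * q + 2 + k with hx
  have hsq : s < (q + 1) * (q + 1) := Nat.lt_succ_sqrt s
  have hx2 : s ≤ x.choose 2 := by
    rw [Nat.choose_two_right, Nat.le_div_iff_mul_le two_pos]
    have h1 : 2 * q + 2 ≤ x := by omega
    have h2 : 2 * q + 1 ≤ x - 1 := by omega
    calc s * 2 ≤ (2 * q + 2) * (2 * q + 1) := by nlinarith
      _ ≤ x * (x - 1) := Nat.mul_le_mul h1 h2
  have hcore := choose_le_of_listing O hQ hs good hgood hmost hn hx2 hk (by omega)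
  have hsqrt : (x : ℝ) ≤ (k + 4) * √s := by
    have h1 : (q : ℝ) ≤ √s := Real.nat_sqrt_le_real_sqrt
    have h2 : (1 : ℝ) ≤ √s := Real.one_le_sqrt.2 (by exact_mod_cast hs1)
    rw [hx]
    push_cast
    nlinarith [(Nat.cast_nonneg k : (0 : ℝ) ≤ k)]
  have hpow : (x : ℝ) ^ k ≤ (k + 4) ^ k * (s : ℝ) ^ ((k : ℝ) / 2) := by
    calc (x : ℝ) ^ k ≤ ((k + 4) * √s) ^ k := by gcongr
      _ = (k + 4) ^ k * (s : ℝ) ^ ((k : ℝ) / 2) := by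
        rw [mul_pow, Real.sqrt_eq_rpow, ← Real.rpow_mul_natCast (Nat.cast_nonneg s)]
        congr 2
        ring
  have hnat : n ^ k ≤ 2 ^ k * k.factorial * (2 * 2 ^ k ^ 2 * Fintype.card ι * x ^ k) :=
    (pow_le_mul_choose hnk).trans (Nat.mul_le_mul_left _ hcore)
  calc (n : ℝ) ^ k
      ≤ 2 ^ k * k.factorial * (2 * 2 ^ k ^ 2 * Fintype.card ι * (x : ℝ) ^ k) := by
        exact_mod_cast hnat
    _ ≤ 2 ^ k * k.factorial * (2 * 2 ^ k ^ 2 * Fintype.card ι *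
          ((k + 4) ^ k * (s : ℝ) ^ ((k : ℝ) / 2))) := by gcongr
    _ = _ := by
        simp only [listingConst]
        push_cast
        ring

theorem rpow_half_le_pow {a : ℝ} (ha : 1 ≤ a) (k : ℕ) : a ^ ((k : ℝ) / 2) ≤ a ^ k := by
  rw [← Real.rpow_natCast]
  exact Real.rpow_le_rpow_of_exponent_le ha (by linarith [(Nat.cast_nonneg k : (0 : ℝ) ≤ k)])

theorem mul_self_le_two_pow {n : ℕ} (hn : 4 ≤ n) : n * n ≤ 2 ^ n := by
  induction n, hn using Nat.le_induction with
  | base => norm_num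
  | succ m hm ih => rw [pow_succ]; nlinarith

namespace Algorithm

variable {n μ b : ℕ}

/-- The bound for algorithms that run long enough for a node to receive `μ` messages: cut the
execution into windows of `μ / ℓ` rounds, in which a node depends on `O(b * μ)` bits only. -/
theorem pow_le_of_long {k ℓ R : ℕ} (A : Algorithm n μ b) (M : CommModel) (hk : 2 ≤ k)
    (hn : 4 * 2 ^ k ^ 2 ≤ n) (hnk : 2 * k ≤ n) (hℓ : 1 ≤ ℓ) (hℓμ : ℓ ≤ μ) (hb : 1 ≤ b)
    (hnb : n ≤ 2 ^ b) (hA : A.ReceivesAtMost M ℓ)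
    (hmost : (Finset.univ.filter fun G => ¬ A.ListsCliques M k R G).card * n ≤
      Fintype.card (SimpleGraph (Fin n)))
    (hR : μ / ℓ ≤ R) (hRn : R < n ^ (k - 1)) :
    (n : ℝ) ^ (k - 1) ≤ 4 * listingConst k * (k + 5) ^ k *
      (((b : ℝ) * μ) ^ ((k : ℝ) / 2 - 1) * (b * ℓ) * R) := by
  set T := μ / ℓ with hT
  -- a window depends on `4 * (b * μ)` bits; the other `(k + 1) * (b * μ)` in `s` pay for a union
  -- bound over at most `n ^ k` windows with failure probability `1 / n`, as `n ≤ 2 ^ b`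
  have hT0 : 0 < T := Nat.div_pos hℓμ hℓ
  have hTℓ : T * ℓ ≤ μ := Nat.div_mul_le_self μ ℓ
  have hμT : μ ≤ 2 * (T * ℓ) := by
    have h1 := Nat.div_add_mod μ ℓ
    have h2 := Nat.mod_lt μ hℓ
    rw [← hT, mul_comm] at h1
    have h3 : 1 * ℓ ≤ T * ℓ := Nat.mul_le_mul_right _ hT0
    omega
  have hμ : 1 ≤ μ := hℓ.trans hℓμ
  have hn1 : 1 ≤ n := le_trans (by have := Nat.one_le_two_pow (n := k ^ 2); omega) hn
  have hlist := pow_le_of_listing (k := k) (Q := 2 ^ (4 * (b * μ))) (s := (k + 5) * (b * μ))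
    (fun p : Fin n × Fin (R / T + 1) =>
      A.windowOutput M p.1 (p.2 * T) (min T (R - p.2 * T)))
    (by
      rintro ⟨v, j⟩
      refine (A.ncard_range_windowOutput_le M hA hb hnb v _ _
        (fun G => A.memory M G (j * T) v) id fun _ => rfl).trans ?_
      rw [card_memory, ← pow_add]
      refine Nat.pow_le_pow_right two_pos ?_
      have : 3 * b * ℓ * min T (R - j * T) ≤ 3 * b * μ :=
        calc 3 * b * ℓ * min T (R - j * T) ≤ 3 * b * ℓ * T := by gcongr; exact min_le_left _ _
          _ = 3 * b * (T * ℓ) := by ring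
          _ ≤ _ := by gcongr
      linarith)
    (by
      have h1 : R / T + 1 ≤ n ^ (k - 1) := (Nat.succ_le_succ (Nat.div_le_self R T)).trans hRn
      have h2 : n ≤ 2 ^ (b * μ) :=
        hnb.trans (Nat.pow_le_pow_right two_pos (Nat.le_mul_of_pos_right b hμ))
      rw [Fintype.card_prod, Fintype.card_fin, Fintype.card_fin]
      calc n * (R / T + 1) * n * 2 ^ (4 * (b * μ))
          ≤ n * n ^ (k - 1) * n * 2 ^ (4 * (b * μ)) := by gcongr
        _ = n ^ (k + 1) * 2 ^ (4 * (b * μ)) := by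
            congr 1
            rw [← pow_succ', ← pow_succ]
            congr 1
            omega
        _ ≤ (2 ^ (b * μ)) ^ (k + 1) * 2 ^ (4 * (b * μ)) := by gcongr
        _ = 2 ^ ((k + 5) * (b * μ)) := by
            rw [← pow_mul, ← pow_add]
            congr 1
            ring)
    (fun G => A.ListsCliques M k R G)
    (by
      intro G hG
      rw [Set.iUnion_prod', ← hG]
      exact Set.iUnion_congr fun v => A.iUnion_windowOutput M v hT0 G)
    hmost hn hnk hk (by nlinarith [Nat.mul_le_mul hb hμ])
  rw [Fintype.card_prod, Fintype.card_fin, Fintype.card_fin] at hlist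
  have hbμ : (0 : ℝ) < (b : ℝ) * μ := by
    have := Nat.mul_pos hb hμ
    exact_mod_cast this
  have hμ0 : (0 : ℝ) < μ := by exact_mod_cast hμ
  have hn0 : (0 : ℝ) < n := by exact_mod_cast hn1
  have hwin : ((R / T + 1 : ℕ) : ℝ) * μ ≤ 4 * R * ℓ := by
    have h1 : (R / T + 1) * T ≤ 2 * R := by
      have := Nat.div_mul_le_self R T
      rw [add_mul]
      omega
    have h2 : (R / T + 1) * μ ≤ 4 * R * ℓ :=
      calc (R / T + 1) * μ ≤ (R / T + 1) * (2 * (T * ℓ)) := by gcongr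
        _ = 2 * ((R / T + 1) * T) * ℓ := by ring
        _ ≤ 2 * (2 * R) * ℓ := by gcongr
        _ = 4 * R * ℓ := by ring
    exact_mod_cast h2
  have hpow : (((k + 5) * (b * μ) : ℕ) : ℝ) ^ ((k : ℝ) / 2) ≤
      (k + 5) ^ k * (((b : ℝ) * μ) ^ ((k : ℝ) / 2 - 1) * (b * μ)) := by
    push_cast
    rw [Real.mul_rpow (by positivity) hbμ.le]
    have h1 : ((b : ℝ) * μ) ^ ((k : ℝ) / 2 - 1) * (b * μ) = ((b : ℝ) * μ) ^ ((k : ℝ) / 2) := by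
      rw [← Real.rpow_add_one hbμ.ne', sub_add_cancel]
    rw [h1]
    gcongr
    exact rpow_half_le_pow (by linarith [(Nat.cast_nonneg k : (0 : ℝ) ≤ k)]) k
  refine le_of_mul_le_mul_left ?_ hn0
  set Y := ((b : ℝ) * μ) ^ ((k : ℝ) / 2 - 1) with hY
  have hY0 : 0 ≤ Y := Real.rpow_nonneg hbμ.le _
  calc (n : ℝ) * (n : ℝ) ^ (k - 1) = (n : ℝ) ^ k := by
        rw [← pow_succ']
        congr 1
        omega
    _ ≤ _ := hlist
    _ ≤ listingConst k * ((n * (R / T + 1) : ℕ) : ℝ) * ((k + 5) ^ k * (Y * (b * μ))) := by gcongr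
    _ = n * (listingConst k * (k + 5) ^ k * Y * b) * (((R / T + 1 : ℕ) : ℝ) * μ) := by
        push_cast
        ring
    _ ≤ n * (listingConst k * (k + 5) ^ k * Y * b) * (4 * R * ℓ) := by gcongr
    _ = _ := by ring

/-- The bound for algorithms that stop before a node can receive more than `μ` messages. Here the
whole execution is one window, and the output of a node depends on its neighbourhood and on
the messages received. With fewer than `n` bits of messages a node could list only cliques on `O(n)`
edges, which is too little. -/
theorem pow_le_of_short {k ℓ R : ℕ} (A : Algorithm n μ b) (M : CommModel) (hk : 3 ≤ k)
    (hn : 4 * 2 ^ k ^ 2 ≤ n) (hnk : 2 * k ≤ n) (hn4 : 4 ≤ n)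
    (hnC : (listingConst k * 5 ^ k) ^ 2 < n) (hb : 1 ≤ b)
    (hnb : n ≤ 2 ^ b) (hA : A.ReceivesAtMost M ℓ)
    (hmost : (Finset.univ.filter fun G => ¬ A.ListsCliques M k R G).card * n ≤
      Fintype.card (SimpleGraph (Fin n)))
    (hR : R * ℓ ≤ μ) :
    (n : ℝ) ^ (k - 1) ≤ listingConst k * 5 ^ k *
      (((b : ℝ) * μ) ^ ((k : ℝ) / 2 - 1) * (b * ℓ) * R) := by
  set y := b * ℓ * R with hy
  have hlist := pow_le_of_listing (k := k) (Q := 2 ^ (n + 3 * y)) (s := 2 * n + 3 * y)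
    (fun v : Fin n => A.windowOutput M v 0 R)
    (by
      intro v
      refine (A.ncard_range_windowOutput_le M hA hb hnb v _ _
        (fun G => G.neighborSet v) (A.init v) fun _ => rfl).trans ?_
      rw [Fintype.card_set, Fintype.card_fin, ← pow_add, hy]
      refine le_of_eq ?_
      ring)
    (by
      have hsq := mul_self_le_two_pow hn4
      rw [Fintype.card_fin]
      calc n * n * 2 ^ (n + 3 * y) ≤ 2 ^ n * 2 ^ (n + 3 * y) := by gcongr
        _ = _ := by rw [← pow_add]; congr 1; ring)
    (fun G => A.ListsCliques M k R G)
    (by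
      intro G hG
      rw [← hG]
      exact Set.iUnion_congr fun v => A.windowOutput_zero M v R G)
    hmost hn hnk (by omega) (by omega)
  rw [Fintype.card_fin] at hlist
  have hn0 : (0 : ℝ) < n := by exact_mod_cast (by omega : 0 < n)
  set D : ℝ := listingConst k * 5 ^ k with hD
  have hD0 : 0 < D := by
    have := listingConst_pos k
    positivity
  have hmain : ∀ z : ℕ, 2 * n + 3 * y ≤ 5 * z →
      (n : ℝ) ^ (k - 1) ≤ D * (z : ℝ) ^ ((k : ℝ) / 2) := by
    intro z hz
    refine le_of_mul_le_mul_left ?_ hn0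
    have hz' : ((2 * n + 3 * y : ℕ) : ℝ) ≤ 5 * z := by exact_mod_cast hz
    calc (n : ℝ) * (n : ℝ) ^ (k - 1) = (n : ℝ) ^ k := by
          rw [← pow_succ']
          congr 1
          omega
      _ ≤ _ := hlist
      _ ≤ listingConst k * n * (5 * z : ℝ) ^ ((k : ℝ) / 2) := by gcongr
      _ ≤ listingConst k * n * (5 ^ k * (z : ℝ) ^ ((k : ℝ) / 2)) := by
          rw [Real.mul_rpow (by norm_num) (Nat.cast_nonneg z)]
          gcongr
          exact rpow_half_le_pow (by norm_num) k
      _ = _ := by rw [hD]; ring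
  have hk3 : (3 : ℝ) ≤ k := by exact_mod_cast hk
  rcases le_or_gt n y with hny | hyn
  · have hy0 : (0 : ℝ) < y := by exact_mod_cast (by omega : 0 < y)
    have hyμ : (y : ℝ) ≤ (b : ℝ) * μ := by
      have : y ≤ b * μ := by
        rw [hy, mul_assoc, mul_comm ℓ R]
        gcongr
      exact_mod_cast this
    calc (n : ℝ) ^ (k - 1) ≤ D * (y : ℝ) ^ ((k : ℝ) / 2) := hmain y (by omega)
      _ = D * ((y : ℝ) ^ ((k : ℝ) / 2 - 1) * y) := by
          rw [← Real.rpow_add_one hy0.ne', sub_add_cancel]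
      _ ≤ D * (((b : ℝ) * μ) ^ ((k : ℝ) / 2 - 1) * y) := by
          gcongr
          linarith
      _ = _ := by rw [hy]; push_cast; ring
  · -- now `n ^ (k - 1) ≤ D * n ^ (k / 2)`, which fails for large `n` as `k - 1 - k / 2 ≥ 1 / 2`
    exfalso
    have h1 := hmain n (by omega)
    have h2 : (n : ℝ) ^ (k - 1) = (n : ℝ) ^ ((k : ℝ) / 2 - 1) * (n : ℝ) ^ ((k : ℝ) / 2) := by
      rw [← Real.rpow_add hn0, ← Real.rpow_natCast]
      congr 1
      push_cast [Nat.cast_sub (by omega : 1 ≤ k)]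
      ring
    rw [h2] at h1
    have h3 : (n : ℝ) ^ ((k : ℝ) / 2 - 1) ≤ D :=
      le_of_mul_le_mul_right h1 (Real.rpow_pos_of_pos hn0 _)
    have h4 : √n ≤ (n : ℝ) ^ ((k : ℝ) / 2 - 1) := by
      rw [Real.sqrt_eq_rpow]
      exact Real.rpow_le_rpow_of_exponent_le (by exact_mod_cast (by omega : 1 ≤ n)) (by linarith)
    have h5 : (n : ℝ) ≤ D ^ 2 := (Real.sqrt_le_left hD0.le).1 (h4.trans h3)
    have h6 : D ^ 2 < n := by
      rw [hD]
      exact_mod_cast hnC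
    linarith

end Algorithm

end Bounds

end MuCongest

theorem theorem1 (k : ℕ) (hk : 3 ≤ k) :
    ∃ c : ℝ, 0 < c ∧ ∃ n₀ : ℕ, ∀ n : ℕ, n₀ ≤ n →
      ∀ (ℓ μ b : ℕ), 1 ≤ ℓ → ℓ ≤ n → ℓ ≤ μ → (μ : ℝ) ≤ (n : ℝ) ^ (2 - 2 / (k : ℝ)) →
        n ≤ 2 ^ b →
      ∀ (M : MuCongest.CommModel) (Ω : Type) [MeasurableSpace Ω] (P : Measure Ω)
        [IsProbabilityMeasure P] (A : Ω → MuCongest.Algorithm n μ b) (R : ℕ),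
        (∀ ω, (A ω).ReceivesAtMost M ℓ) →
        MuCongest.ListsCliquesWHP P A M k R →
        c * ((n : ℝ) ^ (k - 1) /
            (((b : ℝ) * (μ : ℝ)) ^ ((k : ℝ) / 2 - 1) * ((b : ℝ) * (ℓ : ℝ)))) ≤ (R : ℝ) ∧
        c * ((n : ℝ) ^ (k - 2) /
            (((b : ℝ) * (μ : ℝ)) ^ ((k : ℝ) / 2 - 1) * (b : ℝ))) ≤ (R : ℝ) := by
  set D := MuCongest.listingConst k with hD
  have hD1 : (1 : ℝ) ≤ D := by exact_mod_cast MuCongest.listingConst_pos k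
  have hk3 : (3 : ℝ) ≤ k := by exact_mod_cast hk
  set E : ℝ := 4 * D * (k + 5) ^ k with hE
  have hpow1 : (1 : ℝ) ≤ (k + 5) ^ k := one_le_pow₀ (by linarith)
  have hE1 : 1 ≤ E := by nlinarith
  have hDE : D * 5 ^ k ≤ E := by
    calc (D : ℝ) * 5 ^ k ≤ (4 * D) * (k + 5) ^ k := by
          gcongr
          · linarith
          · linarith
      _ = E := rfl
  -- the summands of `n₀` are the size conditions of `pow_le_of_long` and `pow_le_of_short`
  refine ⟨1 / E, by positivity, 4 * 2 ^ k ^ 2 + 2 * k + (D * 5 ^ k) ^ 2 + 4, ?_⟩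
  intro n hn ℓ μ b hℓ hℓn hℓμ _ hnb M Ω _ P _ A R hA hlists
  have hb : 1 ≤ b := by
    by_contra! h
    have : b = 0 := by omega
    subst this
    omega
  have hμ : 1 ≤ μ := hℓ.trans hℓμ
  have hbr : (1 : ℝ) ≤ b := by exact_mod_cast hb
  have hμr : (1 : ℝ) ≤ μ := by exact_mod_cast hμ
  have hℓr : (1 : ℝ) ≤ ℓ := by exact_mod_cast hℓ
  have hn0 : (0 : ℝ) < n := by exact_mod_cast (by omega : 0 < n)
  have hY1 : 1 ≤ ((b : ℝ) * μ) ^ ((k : ℝ) / 2 - 1) :=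
    Real.one_le_rpow (by nlinarith) (by linarith)
  set Y := ((b : ℝ) * μ) ^ ((k : ℝ) / 2 - 1) with hY
  have hmain : (n : ℝ) ^ (k - 1) ≤ E * (Y * (b * ℓ) * R) := by
    -- the union bound over windows needs `R` polynomial in `n`; otherwise the bound is trivial
    rcases lt_or_ge R (n ^ (k - 1)) with hRn | hRn
    · obtain ⟨ω, hω⟩ := hlists.exists_deterministic (by omega)
      rcases le_or_gt (μ / ℓ) R with hR | hR
      · exact (A ω).pow_le_of_long M (by omega) (by omega) (by omega) hℓ hℓμ hb hnb (hA ω) hω hR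
          hRn
      · have hRℓ : R * ℓ ≤ μ :=
          (Nat.mul_le_mul_right ℓ hR.le).trans (Nat.div_mul_le_self μ ℓ)
        refine ((A ω).pow_le_of_short M hk (by omega) (by omega) (by omega)
          (show (D * 5 ^ k) ^ 2 < n by omega) hb hnb (hA ω) hω hRℓ).trans ?_
        gcongr
    · have hRr : (n : ℝ) ^ (k - 1) ≤ R := by exact_mod_cast hRn
      have h1 : 1 ≤ E * (Y * (b * ℓ)) :=
        one_le_mul_of_one_le_of_one_le hE1
          (one_le_mul_of_one_le_of_one_le hY1 (one_le_mul_of_one_le_of_one_le hbr hℓr))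
      calc (n : ℝ) ^ (k - 1) ≤ 1 * R := by rwa [one_mul]
        _ ≤ E * (Y * (b * ℓ)) * R := by gcongr
        _ = _ := by ring
  have hfirst : 1 / E * ((n : ℝ) ^ (k - 1) / (Y * (b * ℓ))) ≤ R := by
    rw [one_div_mul_eq_div, div_div, div_le_iff₀ (by positivity)]
    linarith
  refine ⟨hfirst, le_trans ?_ hfirst⟩
  have hℓn' : (ℓ : ℝ) ≤ n := by exact_mod_cast hℓn
  gcongr 1 / E * ?_
  rw [div_le_div_iff₀ (by positivity) (by positivity)]
  have hpow : (n : ℝ) ^ (k - 1) = n ^ (k - 2) * n := by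
    rw [← pow_succ]
    congr 1
    omega
  calc (n : ℝ) ^ (k - 2) * (Y * (b * ℓ)) ≤ n ^ (k - 2) * (Y * (b * n)) := by gcongr
    _ = n ^ (k - 1) * (Y * b) := by rw [hpow]; ring
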